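/- Let $A$ be a real $m\times n$ matrix with $m\ge n$ and full column rank, let $x_*\in\mathbb R^n$ be the solution of a consistent linear system $Ax=b$, let $1\le s\le m$, let $c>3$ be real, and let $N\ge 1$ be an integer with $64\,c\,m^2\log m\le N\le e^{m/3}$. Write $\kappa(A)=\sigma_{\max}(A)/\sigma_{\min}(A)$ for the ratio of the largest to the smallest singular value of $A$, and $M^\dagger$ for the Moore–Penrose inverse of a matrix $M$. Let $S^{(1)},\dots,S^{(N)}$ be random $m\times s$ matrices all of whose entries are i.i.d. standard normal variables. Then, with probability at least $1-1.1\,m^{3-c}$ over the collection $\{S^{(1)},\dots,S^{(N)}\}$, the following holds for every initial estimate $x_0\in\mathbb R^n$ and every $k\ge 0$: if the iterates are given by $$x_{j+1}=\bigl(\mathrm{Id}-(S_j^TA)^\dagger S_j^TA\bigr)x_j+(S_j^TA)^\dagger S_j^Tb ,\qquad j\ge 0,$$ where the sketches $S_0,S_1,\dots$ are drawn independently and uniformly at random (with replacement) from the collection, independently of how the collection was generated, then $$\mathbb E\,\|x_k-x_*\|_2^2\;\le\;\Bigl(1-\frac{s}{36\,m\,\kappa^2(A)}\Bigr)^k\|x_0-x_*\|_2^2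 ,$$ where the expectation is over the draws $S_0,\dots,S_{k-1}$ only, the collection being fixed. -/

import Mathlib

open MeasureTheory ProbabilityTheory Matrix

/-- `X` is a Moore-Penrose inverse of the real matrix `M`: the four Penrose equations hold. -/
structure IsMoorePenroseInverse {p q : ℕ} (M : Matrix (Fin p) (Fin q) ℝ)
    (X : Matrix (Fin q) (Fin p) ℝ) : Prop where
  mul_mul_self : M * X * M = M
  self_mul_mul : X * M * X = X
  symm_left : (M * X)ᵀ = M * X
  symm_right : (X * M)ᵀ = X * M

theorem IsMoorePenroseInverse.unique {p q : ℕ} {M : Matrix (Fin p) (Fin q) ℝ}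
    {X Y : Matrix (Fin q) (Fin p) ℝ} (hX : IsMoorePenroseInverse M X)
    (hY : IsMoorePenroseInverse M Y) : X = Y := by
  have h1 : M * X = M * Y := by
    calc M * X = (M * X)ᵀ := hX.symm_left.symm
      _ = ((M * Y * M) * X)ᵀ := by rw [hY.mul_mul_self]
      _ = (M * X)ᵀ * (M * Y)ᵀ := by
          rw [← Matrix.transpose_mul]; congr 1; simp only [Matrix.mul_assoc]
      _ = (M * X * M) * Y := by
          rw [hX.symm_left, hY.symm_left]; simp only [Matrix.mul_assoc]
      _ = M * Y := by rw [hX.mul_mul_self]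
  have h2 : X * M = Y * M := by
    calc X * M = (X * M)ᵀ := hX.symm_right.symm
      _ = (X * (M * Y * M))ᵀ := by rw [hY.mul_mul_self]
      _ = (Y * M)ᵀ * (X * M)ᵀ := by
          rw [← Matrix.transpose_mul]; congr 1; simp only [Matrix.mul_assoc]
      _ = Y * (M * X * M) := by
          rw [hX.symm_right, hY.symm_right]; simp only [Matrix.mul_assoc]
      _ = Y * M := by rw [hX.mul_mul_self]
  calc X = X * M * X := hX.self_mul_mul.symm
    _ = Y * M * Y := by rw [h2, Matrix.mul_assoc, h1, ← Matrix.mul_assoc]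
    _ = Y := hY.self_mul_mul

/-- A symmetric real matrix has a symmetric commuting generalised inverse. -/
theorem exists_symm_generalized_inverse {q : ℕ} (H : Matrix (Fin q) (Fin q) ℝ)
    (hH : H.IsHermitian) :
    ∃ K : Matrix (Fin q) (Fin q) ℝ, Kᵀ = K ∧ H * K * H = H ∧ K * H * K = K ∧ H * K = K * H := by
  obtain ⟨U, V, d, hVU, hV, hHd⟩ : ∃ (U V : Matrix (Fin q) (Fin q) ℝ) (d : Fin q → ℝ),
      V * U = 1 ∧ V = Uᵀ ∧ H = U * diagonal d * V := by
    refine ⟨hH.eigenvectorUnitary, star (hH.eigenvectorUnitary : Matrix (Fin q) (Fin q) ℝ),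
      hH.eigenvalues, ?_, ?_, ?_⟩
    · exact Unitary.coe_star_mul_self hH.eigenvectorUnitary
    · rw [Matrix.star_eq_conjTranspose, Matrix.conjTranspose_eq_transpose_of_trivial]
    · have := hH.spectral_theorem
      rw [Unitary.conjStarAlgAut_apply] at this
      simpa using this
  have key : ∀ e f : Fin q → ℝ,
      (U * diagonal e * V) * (U * diagonal f * V) = U * diagonal (fun i => e i * f i) * V := by
    intro e f
    calc (U * diagonal e * V) * (U * diagonal f * V)
        = U * diagonal e * (V * U) * diagonal f * V := by simp only [Matrix.mul_assoc]
      _ = U * diagonal (fun i => e i * f i) * V := by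
          rw [hVU, Matrix.mul_one, Matrix.mul_assoc U, Matrix.diagonal_mul_diagonal]
  refine ⟨U * diagonal (fun i => (d i)⁻¹) * V, ?_, ?_, ?_, ?_⟩
  · subst hV
    simp [Matrix.transpose_mul, Matrix.mul_assoc]
  · rw [hHd, key, key]
    congr 3; ext i; exact mul_inv_mul_cancel (d i)
  · rw [hHd, key, key]
    congr 3; ext i
    by_cases h : d i = 0 <;> simp [h]
  · rw [hHd, key, key]
    congr 3; ext i; exact mul_comm _ _

theorem exists_isMoorePenroseInverse {p q : ℕ} (M : Matrix (Fin p) (Fin q) ℝ) :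
    ∃ X, IsMoorePenroseInverse M X := by
  obtain ⟨K, hKt, h1, h2, h3⟩ := exists_symm_generalized_inverse (Mᵀ * M)
    (by rw [← Matrix.conjTranspose_eq_transpose_of_trivial]
        exact Matrix.isHermitian_conjTranspose_mul_self M)
  have hHt : (Mᵀ * M)ᵀ = Mᵀ * M := by simp
  have hsymm : (K * (Mᵀ * M))ᵀ = K * (Mᵀ * M) := by
    rw [Matrix.transpose_mul, hHt, hKt, h3]
  have h1' : Mᵀ * M * (K * (Mᵀ * M)) = Mᵀ * M := by rw [← Matrix.mul_assoc, h1]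
  have hM : M * (K * (Mᵀ * M)) = M := by
    have h0 : (M * (K * (Mᵀ * M)) - M)ᵀ * (M * (K * (Mᵀ * M)) - M) = 0 := by
      have : Mᵀ * (M * (K * (Mᵀ * M)) - M) = 0 := by
        rw [Matrix.mul_sub, ← Matrix.mul_assoc, h1', sub_self]
      rw [Matrix.transpose_sub, Matrix.transpose_mul, Matrix.sub_mul, Matrix.mul_assoc, this,
        Matrix.mul_zero, sub_zero]
    rw [← Matrix.conjTranspose_eq_transpose_of_trivial,
      Matrix.conjTranspose_mul_self_eq_zero] at h0
    exact sub_eq_zero.mp h0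
  refine ⟨K * Mᵀ, ?_, ?_, ?_, ?_⟩
  · calc M * (K * Mᵀ) * M = M * (K * (Mᵀ * M)) := by simp only [Matrix.mul_assoc]
      _ = M := hM
  · calc K * Mᵀ * M * (K * Mᵀ) = (K * (Mᵀ * M) * K) * Mᵀ := by simp only [Matrix.mul_assoc]
      _ = K * Mᵀ := by rw [h2]
  · simp [Matrix.transpose_mul, hKt, Matrix.mul_assoc]
  · rw [Matrix.mul_assoc]; exact hsymm

/-- The Moore-Penrose inverse `M†` of a real matrix. -/
noncomputable def moorePenrose {p q : ℕ} (M : Matrix (Fin p) (Fin q) ℝ) :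
    Matrix (Fin q) (Fin p) ℝ :=
  Classical.choose (exists_isMoorePenroseInverse M)

theorem moorePenrose_spec {p q : ℕ} (M : Matrix (Fin p) (Fin q) ℝ) :
    IsMoorePenroseInverse M (moorePenrose M) :=
  Classical.choose_spec (exists_isMoorePenroseInverse M)

/-- Largest singular value of an `m × n` matrix (square root of the largest eigenvalue of
`Aᵀ A`); Mathlib lists the singular values in decreasing order, starting at index `0`. -/
noncomputable def sigmaMax {m n : ℕ} (A : Matrix (Fin m) (Fin n) ℝ) : ℝ :=
  (Matrix.toEuclideanLin A).singularValues 0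

/-- Smallest singular value of an `m × n` matrix (square root of the smallest of the `n`
eigenvalues of `Aᵀ A`). -/
noncomputable def sigmaMin {m n : ℕ} (A : Matrix (Fin m) (Fin n) ℝ) : ℝ :=
  (Matrix.toEuclideanLin A).singularValues (n - 1)

/-- The condition number `κ(A) = σ_max(A) / σ_min(A)`. -/
noncomputable def condNumber {m n : ℕ} (A : Matrix (Fin m) (Fin n) ℝ) : ℝ :=
  sigmaMax A / sigmaMin A

/-- One sketch-and-project step `x ↦ (Id - (SᵀA)† SᵀA) x + (SᵀA)† Sᵀ b`. -/
noncomputable def sketchStep {m n s : ℕ} (A : Matrix (Fin m) (Fin n) ℝ) (b : Fin m → ℝ)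
    (S : Matrix (Fin m) (Fin s) ℝ) (x : Fin n → ℝ) : Fin n → ℝ :=
  (1 - moorePenrose (Sᵀ * A) * (Sᵀ * A)) *ᵥ x + moorePenrose (Sᵀ * A) *ᵥ (Sᵀ *ᵥ b)

/-- The iterates `x_0, x_1, x_2, …` when the step from `x_k` to `x_{k+1}` uses the sketch of
index `idx k` in the collection `coll`. -/
noncomputable def finiteBGK {m n s N : ℕ} (A : Matrix (Fin m) (Fin n) ℝ) (b : Fin m → ℝ)
    (coll : Fin N → Matrix (Fin m) (Fin s) ℝ) (idx : ℕ → Fin N) (x₀ : Fin n → ℝ) :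
    ℕ → (Fin n → ℝ)
  | 0 => x₀
  | k + 1 => sketchStep A b (coll (idx k)) (finiteBGK A b coll idx x₀ k)

/-- The Euclidean norm of a vector. -/
noncomputable def euclNorm {n : ℕ} (v : Fin n → ℝ) : ℝ := ‖WithLp.toLp 2 v‖

/-- `S k`, `k < N`, are random matrices all of whose entries (within one matrix and across
matrices) are independent standard normal variables. -/
structure IsGaussianCollection {Ω : Type*} [MeasurableSpace Ω] (P : Measure Ω) {m s N : ℕ}
    (S : Fin N → Ω → Matrix (Fin m) (Fin s) ℝ) : Prop where
  hasLaw : ∀ k i j, HasLaw (fun ω => S k ω i j) (gaussianReal 0 1) P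
  indep : iIndepFun (fun (e : Fin N × Fin m × Fin s) ω => S e.1 ω e.2.1 e.2.2) P

/-- `idx 0, idx 1, …` are independent draws, each uniform on the `N` indices
(uniform sampling with replacement). -/
structure IsUniformSampling {Ω : Type*} [MeasurableSpace Ω] (P : Measure Ω) {N : ℕ}
    (idx : ℕ → Ω → Fin N) : Prop where
  hasLaw : ∀ k, HasLaw (idx k) (uniformOn (Set.univ : Set (Fin N))) P
  indep : iIndepFun idx P

/-! One step multiplies the error by `1 - Π`, with `Π` the orthogonal projection onto the row space
of `Sᵀ A`. By Pythagoras the mean squared error drops by the average of `‖Π v‖²` over the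
collection, so it suffices that this average is at least `s / (36 m κ²) ‖v‖²` for every `v`. The
draw at step `k` is independent of the past, so the bound iterates.

The matrix `A` is then removed: `rowProj_transpose_mulVec_le` compares `Π v` with the projection of
`A v` onto the column space of `S`, and the extreme singular values give the factor `κ²`. What
remains is a statement about Gaussian matrices: with high probability the average squared length of
the projections of any `u` onto the column spaces is at least `s / (36 m) ‖u‖²`.

For a fixed unit `u`, testing the projection against `S Sᵀ u / (4m)` gives a lower bound quartic in
the entries, `projLowerBound`. Low-order moments control its Laplace transform
(`mgf_projLowerBound_le`), and Chernoff makes the failure probability at most `exp (-3N/128)`. A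
union bound over `(64m+1)^m` grid points and a perturbation argument (`le_sum_rowProj_of_gridPoint`)
cover all `u`; the lower bound on `N` absorbs the entropy `m log (64m+1)`. -/

theorem euclNorm_sq {n : ℕ} (v : Fin n → ℝ) : euclNorm v ^ 2 = v ⬝ᵥ v := by
  rw [euclNorm, EuclideanSpace.norm_sq_eq]
  simp [dotProduct, sq]

theorem dotProduct_self_nonneg_real {n : ℕ} (v : Fin n → ℝ) : 0 ≤ v ⬝ᵥ v := by
  rw [← euclNorm_sq]; positivity

theorem dotProduct_sq_le {n : ℕ} (v w : Fin n → ℝ) : (v ⬝ᵥ w) ^ 2 ≤ (v ⬝ᵥ v) * (w ⬝ᵥ w) := by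
  simpa [dotProduct, sq] using Finset.sum_mul_sq_le_sq_mul_sq Finset.univ v w

/-- The orthogonal projection `M† M` onto the row space of `M`. -/
noncomputable def rowProj {p q : ℕ} (M : Matrix (Fin p) (Fin q) ℝ) : Matrix (Fin q) (Fin q) ℝ :=
  moorePenrose M * M

/-! ### Orthogonal projections onto row spaces -/

section rowProj

variable {p q : ℕ} (M : Matrix (Fin p) (Fin q) ℝ)

theorem transpose_rowProj : (rowProj M)ᵀ = rowProj M := (moorePenrose_spec M).symm_right

theorem rowProj_mul_self : rowProj M * rowProj M = rowProj M := by
  rw [rowProj, ← Matrix.mul_assoc, (moorePenrose_spec M).self_mul_mul]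

theorem mul_rowProj : M * rowProj M = M := by
  rw [rowProj, ← Matrix.mul_assoc, (moorePenrose_spec M).mul_mul_self]

theorem rowProj_mul_transpose : rowProj M * Mᵀ = Mᵀ := by
  conv_lhs => rw [← transpose_rowProj, ← transpose_mul, mul_rowProj]

theorem rowProj_mulVec_dotProduct (v w : Fin q → ℝ) :
    (rowProj M *ᵥ v) ⬝ᵥ w = v ⬝ᵥ (rowProj M *ᵥ w) := by
  rw [dotProduct_mulVec, ← mulVec_transpose, transpose_rowProj]

theorem rowProj_mulVec_dotProduct_self (v : Fin q → ℝ) :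
    (rowProj M *ᵥ v) ⬝ᵥ (rowProj M *ᵥ v) = v ⬝ᵥ (rowProj M *ᵥ v) := by
  rw [rowProj_mulVec_dotProduct, mulVec_mulVec, rowProj_mul_self]

theorem exists_rowProj_mulVec_eq (v : Fin q → ℝ) : ∃ y, rowProj M *ᵥ v = Mᵀ *ᵥ y :=
  ⟨(moorePenrose M)ᵀ *ᵥ v, by rw [mulVec_mulVec, ← transpose_mul, ← rowProj, transpose_rowProj]⟩

/-- Expand `‖Π v - w‖² ≥ 0` for `w = Mᵀ y` in the row space, where `⟨Π v, w⟩ = ⟨v, w⟩`. Every choice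
of `y` thus certifies a lower bound on the projection without handling a pseudoinverse. -/
theorem le_rowProj_mulVec_dotProduct_self (v : Fin q → ℝ) (y : Fin p → ℝ) :
    2 * (v ⬝ᵥ (Mᵀ *ᵥ y)) - (Mᵀ *ᵥ y) ⬝ᵥ (Mᵀ *ᵥ y)
      ≤ (rowProj M *ᵥ v) ⬝ᵥ (rowProj M *ᵥ v) := by
  have h := dotProduct_self_nonneg_real (rowProj M *ᵥ v - Mᵀ *ᵥ y)
  have h1 : (rowProj M *ᵥ v) ⬝ᵥ (Mᵀ *ᵥ y) = v ⬝ᵥ (Mᵀ *ᵥ y) := by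
    rw [rowProj_mulVec_dotProduct, mulVec_mulVec, rowProj_mul_transpose]
  rw [sub_dotProduct, dotProduct_sub, dotProduct_sub, dotProduct_comm (Mᵀ *ᵥ y) (rowProj M *ᵥ v),
    h1] at h
  linarith

theorem one_sub_rowProj_mulVec_dotProduct_self (v : Fin q → ℝ) :
    ((1 - rowProj M) *ᵥ v) ⬝ᵥ ((1 - rowProj M) *ᵥ v)
      = v ⬝ᵥ v - (rowProj M *ᵥ v) ⬝ᵥ (rowProj M *ᵥ v) := by
  rw [sub_mulVec, one_mulVec, sub_dotProduct, dotProduct_sub, dotProduct_sub,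
    dotProduct_comm (rowProj M *ᵥ v) v, rowProj_mulVec_dotProduct_self]
  ring

theorem rowProj_mulVec_dotProduct_self_le (v : Fin q → ℝ) :
    (rowProj M *ᵥ v) ⬝ᵥ (rowProj M *ᵥ v) ≤ v ⬝ᵥ v := by
  have := one_sub_rowProj_mulVec_dotProduct_self M v
  have := dotProduct_self_nonneg_real ((1 - rowProj M) *ᵥ v)
  linarith

theorem rowProj_mulVec_dotProduct_self_le_add (u v : Fin q → ℝ) :
    (rowProj M *ᵥ v) ⬝ᵥ (rowProj M *ᵥ v)
      ≤ 2 * ((rowProj M *ᵥ u) ⬝ᵥ (rowProj M *ᵥ u)) + 2 * ((v - u) ⬝ᵥ (v - u)) := by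
  have h1 := rowProj_mulVec_dotProduct_self_le M (v - u)
  have h2 := dotProduct_self_nonneg_real (rowProj M *ᵥ u - rowProj M *ᵥ (v - u))
  have h3 : rowProj M *ᵥ v = rowProj M *ᵥ u + rowProj M *ᵥ (v - u) := by
    rw [← mulVec_add]; congr 1; abel
  rw [h3]
  simp only [sub_dotProduct, dotProduct_sub, add_dotProduct, dotProduct_add] at h1 h2 ⊢
  linarith

end rowProj

theorem sketchStep_sub {m n s : ℕ} (A : Matrix (Fin m) (Fin n) ℝ) (b : Fin m → ℝ)
    (xs : Fin n → ℝ) (hxs : A *ᵥ xs = b) (S : Matrix (Fin m) (Fin s) ℝ) (x : Fin n → ℝ) :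
    sketchStep A b S x - xs = (1 - rowProj (Sᵀ * A)) *ᵥ (x - xs) := by
  have h : moorePenrose (Sᵀ * A) *ᵥ (Sᵀ *ᵥ b) = rowProj (Sᵀ * A) *ᵥ xs := by
    rw [← hxs, mulVec_mulVec xs Sᵀ A, mulVec_mulVec, rowProj]
  rw [sketchStep, h, ← rowProj, mulVec_sub, sub_mulVec 1 _ xs, one_mulVec]
  abel

theorem rowProj_transpose_mulVec_le {m n s : ℕ} (A : Matrix (Fin m) (Fin n) ℝ)
    (S : Matrix (Fin m) (Fin s) ℝ) {σ : ℝ} (hσ : 0 < σ)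
    (hA : ∀ z, (Aᵀ *ᵥ z) ⬝ᵥ (Aᵀ *ᵥ z) ≤ σ ^ 2 * (z ⬝ᵥ z)) (v : Fin n → ℝ) :
    (rowProj Sᵀ *ᵥ (A *ᵥ v)) ⬝ᵥ (rowProj Sᵀ *ᵥ (A *ᵥ v))
      ≤ σ ^ 2 * ((rowProj (Sᵀ * A) *ᵥ v) ⬝ᵥ (rowProj (Sᵀ * A) *ᵥ v)) := by
  obtain ⟨y, hy⟩ := exists_rowProj_mulVec_eq Sᵀ (A *ᵥ v)
  set z := rowProj Sᵀ *ᵥ (A *ᵥ v) with hz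
  -- The test vector `Aᵀ z / σ²` lies in the row space of `Sᵀ A` because `z = S y`; it gives
  -- `2‖z‖²/σ² - ‖Aᵀ z‖²/σ⁴ ≥ ‖z‖²/σ²`.
  have h := le_rowProj_mulVec_dotProduct_self (Sᵀ * A) v ((σ ^ 2)⁻¹ • y)
  have h1 : (Sᵀ * A)ᵀ *ᵥ ((σ ^ 2)⁻¹ • y) = (σ ^ 2)⁻¹ • (Aᵀ *ᵥ z) := by
    rw [transpose_mul, ← mulVec_mulVec, mulVec_smul, mulVec_smul, hy]
  have h2 : v ⬝ᵥ (Aᵀ *ᵥ z) = z ⬝ᵥ z := by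
    rw [dotProduct_mulVec, vecMul_transpose, hz, rowProj_mulVec_dotProduct_self]
  have h3 := hA z
  rw [h1, dotProduct_smul, h2, smul_dotProduct, dotProduct_smul] at h
  simp only [smul_eq_mul] at h
  have hs : 0 < σ ^ 2 := by positivity
  have h4 : (σ ^ 2)⁻¹ * ((σ ^ 2)⁻¹ * ((Aᵀ *ᵥ z) ⬝ᵥ (Aᵀ *ᵥ z))) ≤ (σ ^ 2)⁻¹ * (z ⬝ᵥ z) := by
    gcongr
    rw [inv_mul_le_iff₀ hs]; exact h3
  rw [← div_le_iff₀' hs]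
  have : (z ⬝ᵥ z) / σ ^ 2 = (σ ^ 2)⁻¹ * (z ⬝ᵥ z) := by ring
  linarith

/-! ### Singular value bounds and the condition number -/

section singularValues

variable {m n : ℕ} (A : Matrix (Fin m) (Fin n) ℝ)

/-- The `c i` are the coordinates of `v` in an orthonormal eigenbasis of `Aᵀ A`. -/
theorem exists_dotProduct_self_eq_sum_singularValues (v : Fin n → ℝ) :
    ∃ c : Fin n → ℝ, v ⬝ᵥ v = ∑ i, c i ^ 2 ∧
      (A *ᵥ v) ⬝ᵥ (A *ᵥ v) =
        ∑ i : Fin n, (Matrix.toEuclideanLin A).singularValues i ^ 2 * c i ^ 2 := by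
  set T := Matrix.toEuclideanLin A with hT
  have hn : Module.finrank ℝ (EuclideanSpace ℝ (Fin n)) = n := by simp
  set e := T.isSymmetric_adjoint_comp_self.eigenvectorBasis hn
  set x : EuclideanSpace ℝ (Fin n) := WithLp.toLp 2 v
  have h1 : v ⬝ᵥ v = ‖x‖ ^ 2 := (euclNorm_sq v).symm
  have h2 : (A *ᵥ v) ⬝ᵥ (A *ᵥ v) = ‖T x‖ ^ 2 := (euclNorm_sq (A *ᵥ v)).symm
  refine ⟨fun i => e.repr x i, ?_, ?_⟩
  · rw [h1, ← e.repr.norm_map, EuclideanSpace.norm_sq_eq]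
    simp
  · rw [h2, ← real_inner_self_eq_norm_sq, ← LinearMap.adjoint_inner_right,
      ← e.repr.inner_map_map, PiLp.inner_apply]
    refine Finset.sum_congr rfl fun i _ => ?_
    have := T.isSymmetric_adjoint_comp_self.eigenvectorBasis_apply_self_apply hn x i
    rw [LinearMap.comp_apply] at this
    rw [T.sq_singularValues_fin hn]
    change inner ℝ (e.repr x i) (e.repr _ i) = _
    rw [this]
    simp
    ring

theorem mulVec_dotProduct_self_le (v : Fin n → ℝ) :
    (A *ᵥ v) ⬝ᵥ (A *ᵥ v) ≤ sigmaMax A ^ 2 * (v ⬝ᵥ v) := by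
  obtain ⟨c, h1, h2⟩ := exists_dotProduct_self_eq_sum_singularValues A v
  rw [h1, h2, Finset.mul_sum]
  gcongr with i
  · exact LinearMap.singularValues_nonneg _ _
  · exact LinearMap.singularValues_antitone _ (Nat.zero_le _)

theorem le_mulVec_dotProduct_self (v : Fin n → ℝ) :
    sigmaMin A ^ 2 * (v ⬝ᵥ v) ≤ (A *ᵥ v) ⬝ᵥ (A *ᵥ v) := by
  obtain ⟨c, h1, h2⟩ := exists_dotProduct_self_eq_sum_singularValues A v
  rw [h1, h2, Finset.mul_sum]
  gcongr with i
  · exact LinearMap.singularValues_nonneg _ _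
  · exact LinearMap.singularValues_antitone _ (by omega)

theorem transpose_mulVec_dotProduct_self_le (z : Fin m → ℝ) :
    (Aᵀ *ᵥ z) ⬝ᵥ (Aᵀ *ᵥ z) ≤ sigmaMax A ^ 2 * (z ⬝ᵥ z) := by
  set w := Aᵀ *ᵥ z with hw
  have h1 : w ⬝ᵥ w = z ⬝ᵥ (A *ᵥ w) := by
    rw [dotProduct_mulVec z, ← mulVec_transpose]
  have h2 := dotProduct_sq_le z (A *ᵥ w)
  rw [← h1] at h2
  have h3 := mulVec_dotProduct_self_le A w
  have hz := dotProduct_self_nonneg_real z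
  rcases (dotProduct_self_nonneg_real w).eq_or_lt with h | h
  · rw [← h]; positivity
  · have : (w ⬝ᵥ w) ^ 2 ≤ (z ⬝ᵥ z) * (sigmaMax A ^ 2 * (w ⬝ᵥ w)) :=
      h2.trans (mul_le_mul_of_nonneg_left h3 hz)
    nlinarith

/-- A lower bound for the sketches of arbitrary vectors passes to the sketched system, at the price
of the condition number. -/
theorem le_sum_rowProj_mul {s N : ℕ} (coll : Fin N → Matrix (Fin m) (Fin s) ℝ) {δ : ℝ}
    (h0 : 0 ≤ δ) (h : ∀ u : Fin m → ℝ, δ * (u ⬝ᵥ u) ≤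
      ∑ i, (rowProj (coll i)ᵀ *ᵥ u) ⬝ᵥ (rowProj (coll i)ᵀ *ᵥ u)) (v : Fin n → ℝ) :
    δ / condNumber A ^ 2 * (v ⬝ᵥ v) ≤
      ∑ i, (rowProj ((coll i)ᵀ * A) *ᵥ v) ⬝ᵥ (rowProj ((coll i)ᵀ * A) *ᵥ v) := by
  have hnn : 0 ≤ ∑ i, (rowProj ((coll i)ᵀ * A) *ᵥ v) ⬝ᵥ (rowProj ((coll i)ᵀ * A) *ᵥ v) :=
    Finset.sum_nonneg fun i _ => dotProduct_self_nonneg_real _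
  have hs0 : 0 ≤ sigmaMax A := LinearMap.singularValues_nonneg _ _
  rcases hs0.eq_or_lt with h1 | h1
  -- If `σ_max = 0`, then `condNumber A = 0` and the left side vanishes, since division by zero is
  -- zero.
  · simpa [condNumber, ← h1] using hnn
  rw [condNumber, div_pow, div_div_eq_mul_div, div_mul_eq_mul_div, div_le_iff₀' (by positivity)]
  calc δ * sigmaMin A ^ 2 * (v ⬝ᵥ v) = δ * (sigmaMin A ^ 2 * (v ⬝ᵥ v)) := by ring
    _ ≤ δ * ((A *ᵥ v) ⬝ᵥ (A *ᵥ v)) := by gcongr; exact le_mulVec_dotProduct_self A v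
    _ ≤ _ := h _
    _ ≤ _ := by
      rw [Finset.mul_sum]
      gcongr with i
      exact rowProj_transpose_mulVec_le A (coll i) h1 (transpose_mulVec_dotProduct_self_le A) v

end singularValues

/-! ### Moments and linear combinations of standard normal variables -/

section gaussian

variable {Ω : Type*} [MeasurableSpace Ω] {P : Measure Ω} {X Y Z W : Ω → ℝ}

theorem integral_pow_four_gaussianReal : ∫ x, x ^ 4 ∂(gaussianReal 0 1) = 3 := by
  -- The fourth moment is the fourth derivative at `0` of `exp (t²/2)`.
  have h := iteratedDeriv_mgf_zero (X := id) (μ := gaussianReal 0 1)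
    (by simp [integrableExpSet_id_gaussianReal]) 4
  rw [mgf_id_gaussianReal] at h
  have hE : ∀ t : ℝ, HasDerivAt (fun t : ℝ => Real.exp (0 * t + (1 : NNReal) * t ^ 2 / 2))
      (t * Real.exp (0 * t + (1 : NNReal) * t ^ 2 / 2)) t := by
    intro t
    have : HasDerivAt (fun t : ℝ => 0 * t + (1 : NNReal) * t ^ 2 / 2) t t := by
      have := ((hasDerivAt_pow 2 t).div_const 2)
      simpa using this
    simpa [mul_comm] using this.exp
  set E := fun t : ℝ => Real.exp (0 * t + (1 : NNReal) * t ^ 2 / 2) with hEdef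
  have d1 : deriv E = fun t => t * E t := funext fun t => (hE t).deriv
  have d2 : deriv (fun t => t * E t) = fun t => (1 + t ^ 2) * E t := funext fun t =>
    (((hasDerivAt_id' t).fun_mul (hE t)).congr_deriv (by simp only [hEdef]; ring)).deriv
  have d3 : deriv (fun t => (1 + t ^ 2) * E t) = fun t => (3 * t + t ^ 3) * E t := funext fun t =>
    ((((hasDerivAt_pow 2 t).const_add 1).fun_mul (hE t)).congr_deriv
      (by simp only [hEdef]; norm_num; ring)).deriv
  have d4 : deriv (fun t => (3 * t + t ^ 3) * E t) = fun t => (3 + 6 * t ^ 2 + t ^ 4) * E t :=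
    funext fun t =>
      (((((hasDerivAt_id' t).const_mul 3).fun_add (hasDerivAt_pow 3 t)).fun_mul (hE t)).congr_deriv
        (by simp only [hEdef]; norm_num; ring)).deriv
  rw [iteratedDeriv_succ, iteratedDeriv_succ, iteratedDeriv_succ, iteratedDeriv_succ,
    iteratedDeriv_zero, d1, d2, d3, d4] at h
  simpa [hEdef] using h.symm

theorem integral_sq_gaussianReal : ∫ x, x ^ 2 ∂(gaussianReal 0 1) = 1 := by
  have h := variance_fun_id_gaussianReal (μ := 0) (v := 1)
  rw [variance_of_integral_eq_zero (by fun_prop) (by simp)] at h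
  simpa using h

theorem ProbabilityTheory.HasLaw.integral_pow_four (h : HasLaw X (gaussianReal 0 1) P) :
    ∫ ω, X ω ^ 4 ∂P = 3 := by
  rw [← integral_pow_four_gaussianReal]
  exact h.integral_comp (f := fun x : ℝ => x ^ 4) (by fun_prop)

theorem ProbabilityTheory.HasLaw.integral_sq (h : HasLaw X (gaussianReal 0 1) P) :
    ∫ ω, X ω ^ 2 ∂P = 1 := by
  rw [← integral_sq_gaussianReal]
  exact h.integral_comp (f := fun x : ℝ => x ^ 2) (by fun_prop)

theorem ProbabilityTheory.HasLaw.integral_gaussianReal (h : HasLaw X (gaussianReal 0 1) P) :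
    ∫ ω, X ω ∂P = 0 := by
  rw [h.integral_eq]; simp

theorem ProbabilityTheory.HasLaw.integrable_pow_four (h : HasLaw X (gaussianReal 0 1) P) :
    Integrable (fun ω => X ω ^ 4) P := by
  by_contra hc
  have := h.integral_pow_four
  rw [integral_undef hc] at this
  norm_num at this

theorem ProbabilityTheory.HasLaw.integrable_sq (h : HasLaw X (gaussianReal 0 1) P) :
    Integrable (fun ω => X ω ^ 2) P := by
  by_contra hc
  have := h.integral_sq
  rw [integral_undef hc] at this
  norm_num at this

theorem integrable_mul_gaussian (hX : HasLaw X (gaussianReal 0 1) P)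
    (hY : HasLaw Y (gaussianReal 0 1) P) : Integrable (fun ω => X ω * Y ω) P := by
  refine (hX.integrable_sq.add hY.integrable_sq).mono'
    (hX.aemeasurable.mul hY.aemeasurable).aestronglyMeasurable (ae_of_all _ fun ω => ?_)
  simp only [Real.norm_eq_abs, Pi.add_apply]
  rw [abs_le]
  constructor <;> nlinarith [sq_nonneg (X ω + Y ω), sq_nonneg (X ω - Y ω)]

theorem integrable_mul_mul_gaussian (hX : HasLaw X (gaussianReal 0 1) P)
    (hY : HasLaw Y (gaussianReal 0 1) P) (hZ : HasLaw Z (gaussianReal 0 1) P)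
    (hW : HasLaw W (gaussianReal 0 1) P) :
    Integrable (fun ω => (X ω * Y ω) * (Z ω * W ω)) P := by
  refine ((hX.integrable_pow_four.add hY.integrable_pow_four).add
    (hZ.integrable_pow_four.add hW.integrable_pow_four)).mono'
    ((hX.aemeasurable.mul hY.aemeasurable).mul
      (hZ.aemeasurable.mul hW.aemeasurable)).aestronglyMeasurable (ae_of_all _ fun ω => ?_)
  simp only [Real.norm_eq_abs, Pi.add_apply]
  rw [abs_le]
  constructor <;> nlinarith [sq_nonneg (X ω * Y ω + Z ω * W ω), sq_nonneg (X ω * Y ω - Z ω * W ω),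
    sq_nonneg (X ω ^ 2 - Y ω ^ 2), sq_nonneg (Z ω ^ 2 - W ω ^ 2), sq_nonneg (X ω ^ 2),
    sq_nonneg (Y ω ^ 2), sq_nonneg (Z ω ^ 2), sq_nonneg (W ω ^ 2)]

theorem integral_sq_mul_sq_le (hX : HasLaw X (gaussianReal 0 1) P)
    (hY : HasLaw Y (gaussianReal 0 1) P) :
    ∫ ω, (X ω * Y ω) * (X ω * Y ω) ∂P ≤ 3 := by
  have : ∫ ω, (X ω * Y ω) * (X ω * Y ω) ∂P ≤ ∫ ω, (X ω ^ 4 / 2 + Y ω ^ 4 / 2) ∂P := by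
    refine integral_mono (integrable_mul_mul_gaussian hX hY hX hY)
      ((hX.integrable_pow_four.div_const 2).add (hY.integrable_pow_four.div_const 2)) fun ω => ?_
    simp only
    nlinarith [sq_nonneg (X ω ^ 2 - Y ω ^ 2)]
  rw [integral_add (hX.integrable_pow_four.div_const 2) (hY.integrable_pow_four.div_const 2),
    integral_div, integral_div, hX.integral_pow_four, hY.integral_pow_four] at this
  linarith

variable {ι : Type*} {g : ι → Ω → ℝ}

theorem integral_mul_of_iIndepFun [DecidableEq ι] (hg : ∀ a, HasLaw (g a) (gaussianReal 0 1) P)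
    (hi : iIndepFun g P) (a b : ι) : ∫ ω, g a ω * g b ω ∂P = if a = b then 1 else 0 := by
  split_ifs with h
  · subst h
    simp_rw [← sq]
    exact (hg a).integral_sq
  · have := (hi.indepFun h).integral_fun_mul_eq_mul_integral
      (hg a).aemeasurable.aestronglyMeasurable (hg b).aemeasurable.aestronglyMeasurable
    rw [this, (hg a).integral_gaussianReal, zero_mul]

variable [Fintype ι]

theorem integral_mul_sum_of_iIndepFun (hg : ∀ a, HasLaw (g a) (gaussianReal 0 1) P)
    (hi : iIndepFun g P) (u : ι → ℝ) (a : ι) :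
    ∫ ω, g a ω * ∑ b, g b ω * u b ∂P = u a := by
  classical
  simp_rw [Finset.mul_sum, ← mul_assoc]
  rw [integral_finsetSum _ fun b _ => (integrable_mul_gaussian (hg a) (hg b)).mul_const _]
  simp_rw [integral_mul_const, integral_mul_of_iIndepFun hg hi]
  simp

theorem hasLaw_sum_of_iIndepFun (hg : ∀ a, HasLaw (g a) (gaussianReal 0 1) P)
    (hi : iIndepFun g P) (u : ι → ℝ) (hu : ∑ a, u a * u a = 1) :
    HasLaw (fun ω => ∑ b, g b ω * u b) (gaussianReal 0 1) P := by
  have hi' : iIndepFun (fun b ω => g b ω * u b) P :=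
    hi.comp (fun b x => x * u b) fun b => by fun_prop
  have hL : ∀ b, HasGaussianLaw (fun ω => g b ω * u b) P := fun b => by
    have := (hg b).hasGaussianLaw.fun_smul (u b)
    simpa [mul_comm] using this
  have hG := hi'.hasGaussianLaw_fun_sum hL
  have hint : ∀ b, Integrable (fun ω => g b ω * u b) P := fun b => (hL b).integrable
  have h1 : ∫ ω, ∑ b, g b ω * u b ∂P = 0 := by
    rw [integral_finsetSum _ fun b _ => hint b]
    refine Finset.sum_eq_zero fun b _ => ?_
    rw [integral_mul_const, (hg b).integral_gaussianReal, zero_mul]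
  have h2 : Var[fun ω => ∑ b, g b ω * u b; P] = 1 := by
    rw [variance_of_integral_eq_zero hG.aemeasurable h1]
    have : ∀ ω, (∑ b, g b ω * u b) ^ 2 = ∑ a, (g a ω * ∑ b, g b ω * u b) * u a := by
      intro ω
      rw [sq, Finset.sum_mul]
      exact Finset.sum_congr rfl fun a _ => by ring
    simp_rw [this]
    rw [integral_finsetSum]
    · simp_rw [integral_mul_const, integral_mul_sum_of_iIndepFun hg hi, hu]
    · intro a _
      simp_rw [Finset.mul_sum, ← mul_assoc]
      exact (integrable_finsetSum _ fun b _ =>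
        (integrable_mul_gaussian (hg a) (hg b)).mul_const _).mul_const _
  refine ⟨hG.aemeasurable, ?_⟩
  rw [hG.map_eq_gaussianReal, h1, h2]
  simp

end gaussian

section curry

/-- The joint law is a product measure over `ι × κ`, and currying turns it into the product of the
laws of the rows. -/
theorem ProbabilityTheory.iIndepFun.curry_fun {Ω ι κ 𝓧 : Type*} [MeasurableSpace Ω]
    [MeasurableSpace 𝓧] {P : Measure Ω} {X : ι → κ → Ω → 𝓧} (hX : ∀ i j, Measurable (X i j))
    (h : iIndepFun (fun (e : ι × κ) ω => X e.1 e.2 ω) P) :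
    iIndepFun (fun i ω j => X i j ω) P := by
  have := h.isProbabilityMeasure
  have : ∀ i j, IsProbabilityMeasure (P.map (X i j)) :=
    fun i j => Measure.isProbabilityMeasure_map (hX i j).aemeasurable
  have hrow : ∀ i, P.map (fun ω j => X i j ω) = Measure.infinitePi fun j => P.map (X i j) :=
    fun i => (iIndepFun_iff_map_fun_eq_infinitePi_map (hX i)).1
      (h.precomp (g := fun j => (i, j)) fun _ _ hab => (Prod.mk.inj hab).2)
  rw [iIndepFun_iff_map_fun_eq_infinitePi_map (by fun_prop)]
  have h1 := (iIndepFun_iff_map_fun_eq_infinitePi_map (by fun_prop)).1 h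
  have h2 : (MeasurableEquiv.curry ι κ 𝓧) ∘ (fun ω (e : ι × κ) => X e.1 e.2 ω)
      = fun ω i j => X i j ω := rfl
  rw [← h2, ← Measure.map_map (by fun_prop) (by fun_prop), h1,
    Measure.infinitePi_map_curry (fun i j => P.map (X i j))]
  simp_rw [hrow]

end curry

/-- A lower bound for `‖Π u‖²`, where `Π` is the projection onto the column space of `S`, that is
polynomial in the entries of `S` up to truncation at `0`. -/
noncomputable def projLowerBound {m s : ℕ} (u : Fin m → ℝ) (S : Matrix (Fin m) (Fin s) ℝ) : ℝ :=
  max 0 (2 * (4 * m : ℝ)⁻¹ * ((Sᵀ *ᵥ u) ⬝ᵥ (Sᵀ *ᵥ u)) -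
    (4 * m : ℝ)⁻¹ ^ 2 * ((S *ᵥ (Sᵀ *ᵥ u)) ⬝ᵥ (S *ᵥ (Sᵀ *ᵥ u))))

theorem projLowerBound_nonneg {m s : ℕ} (u : Fin m → ℝ) (S : Matrix (Fin m) (Fin s) ℝ) :
    0 ≤ projLowerBound u S := le_max_left _ _

theorem projLowerBound_le {m s : ℕ} (u : Fin m → ℝ) (S : Matrix (Fin m) (Fin s) ℝ) :
    projLowerBound u S ≤ (rowProj Sᵀ *ᵥ u) ⬝ᵥ (rowProj Sᵀ *ᵥ u) := by
  refine max_le (dotProduct_self_nonneg_real _) ?_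
  refine le_trans (le_of_eq ?_)
    (le_rowProj_mulVec_dotProduct_self Sᵀ u ((4 * m : ℝ)⁻¹ • (Sᵀ *ᵥ u)))
  have : u ⬝ᵥ (S *ᵥ (Sᵀ *ᵥ u)) = (Sᵀ *ᵥ u) ⬝ᵥ (Sᵀ *ᵥ u) := by
    rw [dotProduct_mulVec, ← mulVec_transpose]
  rw [transpose_transpose, mulVec_smul, dotProduct_smul, smul_dotProduct, dotProduct_smul, this]
  simp only [smul_eq_mul]
  ring

/-! ### Moments and Laplace transform of the projection bound -/

section moments

variable {Ω : Type*} [MeasurableSpace Ω] {P : Measure Ω} {m s : ℕ}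
  {S : Ω → Matrix (Fin m) (Fin s) ℝ}

theorem measurable_projLowerBound (hm : ∀ i j, Measurable fun ω => S ω i j) (u : Fin m → ℝ) :
    Measurable fun ω => projLowerBound u (S ω) := by
  simp only [projLowerBound, dotProduct, mulVec, transpose_apply]
  fun_prop

variable (hm : ∀ i j, Measurable fun ω => S ω i j)
  (hl : ∀ i j, HasLaw (fun ω => S ω i j) (gaussianReal 0 1) P)
  (hi : iIndepFun (fun (e : Fin m × Fin s) ω => S ω e.1 e.2) P)
  {u : Fin m → ℝ} (hu : u ⬝ᵥ u = 1)

include hm hl hi hu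

omit hm in
theorem hasLaw_transpose_mulVec (j : Fin s) :
    HasLaw (fun ω => ((S ω)ᵀ *ᵥ u) j) (gaussianReal 0 1) P :=
  hasLaw_sum_of_iIndepFun (fun a => hl a j)
    (hi.precomp (g := fun a => (a, j)) fun _ _ hab => (Prod.mk.inj hab).1) u hu

omit hm in
theorem integral_transpose_mulVec_sq :
    Integrable (fun ω => ((S ω)ᵀ *ᵥ u) ⬝ᵥ ((S ω)ᵀ *ᵥ u)) P ∧
      ∫ ω, ((S ω)ᵀ *ᵥ u) ⬝ᵥ ((S ω)ᵀ *ᵥ u) ∂P = s := by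
  have h := hasLaw_transpose_mulVec hl hi hu
  have e : ∀ ω, ((S ω)ᵀ *ᵥ u) ⬝ᵥ ((S ω)ᵀ *ᵥ u) = ∑ j, ((S ω)ᵀ *ᵥ u) j ^ 2 := fun ω =>
    Finset.sum_congr rfl fun j _ => (sq _).symm
  simp_rw [e]
  refine ⟨integrable_finsetSum _ fun j _ => (h j).integrable_sq, ?_⟩
  rw [integral_finsetSum _ fun j _ => (h j).integrable_sq]
  simp [(h _).integral_sq]

omit hm in
theorem integral_transpose_mulVec_pow_four :
    Integrable (fun ω => (((S ω)ᵀ *ᵥ u) ⬝ᵥ ((S ω)ᵀ *ᵥ u)) ^ 2) P ∧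
      ∫ ω, (((S ω)ᵀ *ᵥ u) ⬝ᵥ ((S ω)ᵀ *ᵥ u)) ^ 2 ∂P ≤ 3 * (s : ℝ) ^ 2 := by
  have h := hasLaw_transpose_mulVec hl hi hu
  have e : ∀ ω, (((S ω)ᵀ *ᵥ u) ⬝ᵥ ((S ω)ᵀ *ᵥ u)) ^ 2 = ∑ j, ∑ k,
      (((S ω)ᵀ *ᵥ u) j * ((S ω)ᵀ *ᵥ u) k) * (((S ω)ᵀ *ᵥ u) j * ((S ω)ᵀ *ᵥ u) k) := by
    intro ω
    rw [sq, dotProduct, Finset.sum_mul_sum]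
    exact Finset.sum_congr rfl fun j _ => Finset.sum_congr rfl fun k _ => by ring
  have hint := fun j k => integrable_mul_mul_gaussian (h j) (h k) (h j) (h k)
  simp_rw [e]
  refine ⟨integrable_finsetSum _ fun j _ => integrable_finsetSum _ fun k _ => hint j k, ?_⟩
  rw [integral_finsetSum _ fun j _ => integrable_finsetSum _ fun k _ => hint j k]
  simp_rw [integral_finsetSum _ fun k _ => hint _ k]
  calc _ ≤ ∑ j : Fin s, ∑ k : Fin s, (3 : ℝ) := by
        gcongr with j _ k _
        exact integral_sq_mul_sq_le (h j) (h k)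
    _ = _ := by simp; ring

omit hu in
-- Distinct columns are independent, and each factor has mean `u a`.
theorem integral_mul_transpose_mulVec_mul {j k : Fin s} (hjk : j ≠ k) (a : Fin m) :
    ∫ ω, (S ω a j * ((S ω)ᵀ *ᵥ u) j) * (S ω a k * ((S ω)ᵀ *ᵥ u) k) ∂P = u a * u a := by
  have hcol : iIndepFun (fun (j : Fin s) ω (a : Fin m) => S ω a j) P :=
    iIndepFun.curry_fun (X := fun j a ω => S ω a j) (fun j a => hm a j)
      (hi.precomp (g := Prod.swap) Prod.swap_injective)
  have hf : Measurable fun x : Fin m → ℝ => x a * ∑ b, x b * u b := by fun_prop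
  have hind := (hcol.indepFun hjk).comp hf hf
  have hw : ∀ j, Measurable fun ω => S ω a j * ((S ω)ᵀ *ᵥ u) j := fun j => by
    simp only [dotProduct, mulVec, transpose_apply]
    fun_prop
  have h1 : ∀ j, ∫ ω, S ω a j * ((S ω)ᵀ *ᵥ u) j ∂P = u a := fun j =>
    integral_mul_sum_of_iIndepFun (fun a => hl a j)
      (hi.precomp (g := fun a => (a, j)) fun _ _ hab => (Prod.mk.inj hab).1) u a
  have h2 := hind.integral_fun_mul_eq_mul_integral (hw j).aestronglyMeasurable
    (hw k).aestronglyMeasurable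
  exact h2.trans (congrArg₂ (· * ·) (h1 j) (h1 k))

/-- Off-diagonal pairs of columns contribute `u a ^ 2` each, at most `s²` in total; each of the `m
s` diagonal terms is at most `3`. -/
theorem integral_mulVec_transpose_mulVec_sq :
    Integrable (fun ω => (S ω *ᵥ ((S ω)ᵀ *ᵥ u)) ⬝ᵥ (S ω *ᵥ ((S ω)ᵀ *ᵥ u))) P ∧
      ∫ ω, (S ω *ᵥ ((S ω)ᵀ *ᵥ u)) ⬝ᵥ (S ω *ᵥ ((S ω)ᵀ *ᵥ u)) ∂P ≤
        (s : ℝ) ^ 2 + 3 * m * s := by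
  have h := hasLaw_transpose_mulVec hl hi hu
  have e : ∀ ω, (S ω *ᵥ ((S ω)ᵀ *ᵥ u)) ⬝ᵥ (S ω *ᵥ ((S ω)ᵀ *ᵥ u)) = ∑ a, ∑ j, ∑ k,
      (S ω a j * ((S ω)ᵀ *ᵥ u) j) * (S ω a k * ((S ω)ᵀ *ᵥ u) k) := by
    intro ω
    have hv : ∀ a, (S ω *ᵥ ((S ω)ᵀ *ᵥ u)) a = ∑ j, S ω a j * ((S ω)ᵀ *ᵥ u) j := fun a => rfl
    rw [dotProduct]
    simp_rw [hv, Finset.sum_mul_sum]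
  have hint := fun a j k => integrable_mul_mul_gaussian (hl a j) (h j) (hl a k) (h k)
  simp_rw [e]
  refine ⟨integrable_finsetSum _ fun a _ => integrable_finsetSum _ fun j _ =>
    integrable_finsetSum _ fun k _ => hint a j k, ?_⟩
  rw [integral_finsetSum _ fun a _ => integrable_finsetSum _ fun j _ =>
    integrable_finsetSum _ fun k _ => hint a j k]
  simp_rw [integral_finsetSum _ fun j _ => integrable_finsetSum _ fun k _ => hint _ j k,
    integral_finsetSum _ fun k _ => hint _ _ k]
  calc _ ≤ ∑ a : Fin m, ∑ j : Fin s, ∑ k : Fin s, (u a * u a + if j = k then (3 : ℝ) else 0) := by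
        gcongr with a _ j _ k _
        split_ifs with hjk
        · subst hjk
          have := integral_sq_mul_sq_le (hl a j) (h j)
          have := mul_self_nonneg (u a)
          linarith
        · rw [integral_mul_transpose_mulVec_mul hm hl hi hjk, add_zero]
    _ = (s : ℝ) ^ 2 * (u ⬝ᵥ u) + 3 * m * s := by
        simp only [dotProduct, Finset.sum_add_distrib, Finset.mul_sum, Finset.sum_const,
          Finset.card_univ, Fintype.card_fin, Finset.sum_ite_eq, Finset.mem_univ, if_true,
          nsmul_eq_mul]
        congr 1
        · exact Finset.sum_congr rfl fun a _ => by ring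
        · ring
    _ = _ := by rw [hu, mul_one]

/-- Since the mean of `H` is at most `4ms`, that of `2τF - τ²H` is at least `2τs - 4τ²ms`, maximal
at `τ = 1/(4m)` with value `s/(4m)`. With `l = m/(4s)` the linear term gains `1/16` and the
quadratic one loses `3/128`, a net `5/128`. -/
theorem mgf_projLowerBound_le (hs : 0 < s) (hsm : s ≤ m) :
    mgf (fun ω => projLowerBound u (S ω)) P (-(m / (4 * s))) ≤ Real.exp (-(5 / 128)) := by
  have hP : IsProbabilityMeasure P := hi.isProbabilityMeasure
  have hs' : (0 : ℝ) < s := by exact_mod_cast hs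
  have hm' : (0 : ℝ) < m := by exact_mod_cast hs.trans_le hsm
  have hsm' : (s : ℝ) ≤ m := by exact_mod_cast hsm
  set τ : ℝ := (4 * m : ℝ)⁻¹ with hτ
  set l : ℝ := m / (4 * s) with hlam
  have hl0 : 0 < l := by positivity
  set F : Ω → ℝ := fun ω => ((S ω)ᵀ *ᵥ u) ⬝ᵥ ((S ω)ᵀ *ᵥ u)
  set H : Ω → ℝ := fun ω => (S ω *ᵥ ((S ω)ᵀ *ᵥ u)) ⬝ᵥ (S ω *ᵥ ((S ω)ᵀ *ᵥ u))
  obtain ⟨iF, eF⟩ : Integrable F P ∧ ∫ ω, F ω ∂P = s := integral_transpose_mulVec_sq hl hi hu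
  obtain ⟨iF2, eF2⟩ : Integrable (fun ω => F ω ^ 2) P ∧ ∫ ω, F ω ^ 2 ∂P ≤ 3 * (s : ℝ) ^ 2 :=
    integral_transpose_mulVec_pow_four hl hi hu
  obtain ⟨iH, eH⟩ : Integrable H P ∧ ∫ ω, H ω ∂P ≤ (s : ℝ) ^ 2 + 3 * m * s :=
    integral_mulVec_transpose_mulVec_sq hm hl hi hu
  have hτ0 : 0 < τ := by positivity
  -- The truncation gives `0 ≤ Z ≤ 2τF`, so the quadratic term needs only the second moment of `F`,
  -- never that of `H`.
  have hpt : ∀ ω, Real.exp (-l * projLowerBound u (S ω)) ≤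
      1 - l * (2 * τ * F ω - τ ^ 2 * H ω) + l ^ 2 * (2 * τ ^ 2) * F ω ^ 2 := by
    intro ω
    set Z := projLowerBound u (S ω) with hZ
    have h0 : 0 ≤ Z := projLowerBound_nonneg _ _
    have h1 : 2 * τ * F ω - τ ^ 2 * H ω ≤ Z := le_max_right _ _
    have hF0 : 0 ≤ F ω := dotProduct_self_nonneg_real _
    have hH0 : 0 ≤ H ω := dotProduct_self_nonneg_real _
    have h2 : Z ≤ 2 * τ * F ω := max_le (by positivity) (by
      change 2 * τ * F ω - τ ^ 2 * H ω ≤ _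
      have : 0 ≤ τ ^ 2 * H ω := by positivity
      linarith)
    -- Uses `(1 + x + x²/2)(1 - x + x²/2) = 1 + x⁴/4 ≥ 1`.
    have h3 : Real.exp (-l * Z) ≤ 1 - l * Z + (l * Z) ^ 2 / 2 := by
      have hx : 0 ≤ l * Z := by positivity
      have hq := Real.quadratic_le_exp_of_nonneg hx
      rw [neg_mul, Real.exp_neg, inv_le_comm₀ (Real.exp_pos _) (by nlinarith)]
      refine le_trans ?_ hq
      rw [inv_le_iff_one_le_mul₀ (by nlinarith)]
      nlinarith [sq_nonneg ((l * Z) ^ 2)]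
    have h4 : Z ^ 2 ≤ (2 * τ * F ω) ^ 2 := by gcongr
    have h5 : l ^ 2 * Z ^ 2 ≤ l ^ 2 * (2 * τ * F ω) ^ 2 := by gcongr
    have h6 : l * (2 * τ * F ω - τ ^ 2 * H ω) ≤ l * Z := by gcongr
    nlinarith
  have i1 : Integrable (fun ω => l * (2 * τ * F ω - τ ^ 2 * H ω)) P :=
    ((iF.const_mul _).sub (iH.const_mul _)).const_mul _
  have i2 : Integrable (fun ω => l ^ 2 * (2 * τ ^ 2) * F ω ^ 2) P := iF2.const_mul _
  have i3 : Integrable (fun ω => 1 - l * (2 * τ * F ω - τ ^ 2 * H ω)) P :=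
    (integrable_const _).sub i1
  have hmain : mgf (fun ω => projLowerBound u (S ω)) P (-l) ≤
      1 - l * (2 * τ * ∫ ω, F ω ∂P - τ ^ 2 * ∫ ω, H ω ∂P)
        + l ^ 2 * (2 * τ ^ 2) * ∫ ω, F ω ^ 2 ∂P := by
    have := integral_mono_of_nonneg (ae_of_all P fun ω => (Real.exp_pos _).le) (i3.add i2)
      (ae_of_all P hpt)
    refine this.trans (le_of_eq ?_)
    simp only [Pi.add_apply]
    rw [integral_add i3 i2, integral_sub (integrable_const _) i1, integral_const_mul,
      integral_const_mul, integral_sub (iF.const_mul _) (iH.const_mul _), integral_const_mul,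
      integral_const_mul]
    simp
  refine hmain.trans (le_trans ?_ (Real.add_one_le_exp _))
  have e1 : l * (2 * τ * s - τ ^ 2 * (4 * m * s)) = 1 / 16 := by
    rw [hlam, hτ]; field_simp; norm_num
  have e2 : l ^ 2 * (2 * τ ^ 2) * (3 * (s : ℝ) ^ 2) = 3 / 128 := by
    rw [hlam, hτ]; field_simp; norm_num
  have h1 : l * (2 * τ * s - τ ^ 2 * (4 * m * s)) ≤
      l * (2 * τ * ∫ ω, F ω ∂P - τ ^ 2 * ∫ ω, H ω ∂P) := by
    rw [eF]
    gcongr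
    nlinarith
  have h2 : l ^ 2 * (2 * τ ^ 2) * ∫ ω, F ω ^ 2 ∂P ≤ l ^ 2 * (2 * τ ^ 2) * (3 * (s : ℝ) ^ 2) := by
    gcongr
  linarith

end moments

/-! ### Chernoff bound for one direction -/

section chernoff

variable {Ω : Type*} [MeasurableSpace Ω] {P : Measure Ω} {m s N : ℕ}
  {S : Fin N → Ω → Matrix (Fin m) (Fin s) ℝ}

theorem measureReal_sum_projLowerBound_le (hS : IsGaussianCollection P S)
    (hm : ∀ k i j, Measurable fun ω => S k ω i j) {u : Fin m → ℝ} (hu : u ⬝ᵥ u = 1)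
    (hs : 0 < s) (hsm : s ≤ m) :
    P.real {ω | ∑ k, projLowerBound u (S k ω) ≤ N * s / (16 * m)} ≤
      Real.exp (-(3 / 128 * N)) := by
  have hP : IsProbabilityMeasure P := hS.indep.isProbabilityMeasure
  have hs' : (0 : ℝ) < s := by exact_mod_cast hs
  have hm' : (0 : ℝ) < m := by exact_mod_cast hs.trans_le hsm
  set l : ℝ := m / (4 * s) with hlam
  have hl0 : 0 < l := by positivity
  have hrow : iIndepFun (fun k ω (e : Fin m × Fin s) => S k ω e.1 e.2) P :=
    iIndepFun.curry_fun (X := fun k (e : Fin m × Fin s) ω => S k ω e.1 e.2)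
      (fun k e => hm k e.1 e.2) hS.indep
  have hcurry : ∀ i j, Measurable fun x : Fin m × Fin s → ℝ =>
      (Matrix.of fun i j => x (i, j) : Matrix (Fin m) (Fin s) ℝ) i j := fun i j => by
    simp only [of_apply]; fun_prop
  have hind : iIndepFun (fun k ω => projLowerBound u (S k ω)) P :=
    hrow.comp (fun _ x => projLowerBound u (Matrix.of fun i j => x (i, j)))
      fun _ => measurable_projLowerBound hcurry u
  have hmeas := fun k => measurable_projLowerBound (hm k) u
  have hmgf := hind.mgf_sum hmeas Finset.univ (t := -l)
  have hint : Integrable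
      (fun ω => Real.exp (-l * (∑ k, fun ω => projLowerBound u (S k ω)) ω)) P := by
    refine Integrable.of_bound (C := 1) ?_ (ae_of_all _ fun ω => ?_)
    · simp only [Finset.sum_apply]
      exact (Measurable.aestronglyMeasurable (by fun_prop))
    · rw [Real.norm_of_nonneg (Real.exp_pos _).le, Real.exp_le_one_iff, Finset.sum_apply]
      have := Finset.sum_nonneg fun k (_ : k ∈ Finset.univ) => projLowerBound_nonneg u (S k ω)
      nlinarith
  have hch := measure_le_le_exp_mul_mgf (N * s / (16 * m) : ℝ) (neg_nonpos.2 hl0.le) hint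
  simp only [Finset.sum_apply] at hch
  refine hch.trans ?_
  have hprod : ∏ k : Fin N, mgf (fun ω => projLowerBound u (S k ω)) P (-l) ≤
      Real.exp (-(5 / 128)) ^ N := by
    calc _ ≤ ∏ _k : Fin N, Real.exp (-(5 / 128)) :=
          Finset.prod_le_prod (fun _ _ => mgf_nonneg) fun k _ =>
            mgf_projLowerBound_le (hm k) (hS.hasLaw k)
              (hS.indep.precomp (g := fun e => (k, e)) fun _ _ hab => (Prod.mk.inj hab).2)
              hu hs hsm
      _ = _ := by simp
  rw [hmgf]
  -- The threshold costs `l * N s / (16 m) = N/64`, leaving `5/128 - 2/128 = 3/128` per sketch.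
  refine (mul_le_mul_of_nonneg_left hprod (Real.exp_pos _).le).trans (le_of_eq ?_)
  rw [← Real.exp_nat_mul, ← Real.exp_add, hlam]
  congr 1
  field_simp
  norm_num
  ring

end chernoff

/-! ### From a finite grid to all directions -/

/-- The points of a grid of mesh `1 / (32 m)` in the cube `[-1, 1]^m`. -/
noncomputable def gridPoint (m : ℕ) (g : Fin m → Fin (64 * m + 1)) : Fin m → ℝ :=
  fun a => ((g a : ℕ) - 32 * m : ℝ) / (32 * m)

theorem exists_gridPoint_near {m : ℕ} (hm : 0 < m) (u : Fin m → ℝ) (hu : u ⬝ᵥ u = 1) :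
    ∃ g, (gridPoint m g - u) ⬝ᵥ (gridPoint m g - u) ≤ 1 / (1024 * m) := by
  have hm' : (0 : ℝ) < m := by exact_mod_cast hm
  have hua : ∀ a, u a ^ 2 ≤ 1 := fun a => by
    rw [← hu, dotProduct, sq]
    exact Finset.single_le_sum (f := fun a => u a * u a) (fun _ _ => mul_self_nonneg _)
      (Finset.mem_univ a)
  have h0 : ∀ a, 0 ≤ 32 * m * (u a + 1) := fun a => by
    have := (abs_le.1 ((sq_le_one_iff_abs_le_one _).1 (hua a))).1
    have : 0 ≤ u a + 1 := by linarith
    positivity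
  have h1 : ∀ a, 32 * m * (u a + 1) ≤ 64 * m := fun a => by
    have := (abs_le.1 ((sq_le_one_iff_abs_le_one _).1 (hua a))).2
    nlinarith
  refine ⟨fun a => ⟨⌊32 * m * (u a + 1)⌋₊, Nat.lt_succ_of_le (Nat.floor_le_of_le ?_)⟩, ?_⟩
  · push_cast
    exact h1 a
  calc _ ≤ ∑ _a : Fin m, (1 / (32 * m : ℝ)) ^ 2 := by
        rw [dotProduct]
        gcongr with a
        rw [← sq, sq_le_sq, abs_of_pos (a := 1 / (32 * (m : ℝ))) (by positivity)]
        have hf := Nat.floor_le (h0 a)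
        have hf' := Nat.lt_floor_add_one (32 * m * (u a + 1))
        simp only [Pi.sub_apply, gridPoint]
        rw [div_sub' (by positivity), abs_div, abs_of_pos (a := 32 * (m : ℝ)) (by positivity)]
        gcongr
        rw [abs_le]
        constructor <;> linarith
    _ = _ := by
        simp only [Finset.sum_const, Finset.card_univ, Fintype.card_fin, nsmul_eq_mul]
        field_simp
        norm_num

/-- Compare `u` with a nearby grid point via `‖Π x‖² ≤ 2‖Π u‖² + 2‖x - u‖²`. The target is of order
`s/m`, possibly only `1/m`, so the squared distance must be `O(1/m)`. The constants close since
`(15/256 - 1/512)/2 = 29/1024 > 1/36`. -/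
theorem le_sum_rowProj_of_gridPoint {m s N : ℕ} (hm : 0 < m) (hs : 0 < s)
    (coll : Fin N → Matrix (Fin m) (Fin s) ℝ)
    (h : ∀ g, N * s / (16 * m) * (gridPoint m g ⬝ᵥ gridPoint m g) ≤
      ∑ i, (rowProj (coll i)ᵀ *ᵥ gridPoint m g) ⬝ᵥ (rowProj (coll i)ᵀ *ᵥ gridPoint m g))
    (u : Fin m → ℝ) :
    N * s / (36 * m) * (u ⬝ᵥ u) ≤
      ∑ i, (rowProj (coll i)ᵀ *ᵥ u) ⬝ᵥ (rowProj (coll i)ᵀ *ᵥ u) := by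
  have hm1 : (1 : ℝ) ≤ m := by exact_mod_cast hm
  have hs1 : (1 : ℝ) ≤ s := by exact_mod_cast hs
  have key : ∀ u : Fin m → ℝ, u ⬝ᵥ u = 1 → (N * s / (36 * m) : ℝ) ≤
      ∑ i, (rowProj (coll i)ᵀ *ᵥ u) ⬝ᵥ (rowProj (coll i)ᵀ *ᵥ u) := by
    intro u hu
    obtain ⟨g, hg⟩ := exists_gridPoint_near hm u hu
    set x := gridPoint m g with hx
    set d := (x - u) ⬝ᵥ (x - u) with hd
    have hd0 : 0 ≤ d := dotProduct_self_nonneg_real _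
    have hd1 : d ≤ 1 / 1024 := hg.trans (by gcongr; linarith)
    have hxx : 15 / 16 ≤ x ⬝ᵥ x := by
      have hcs := dotProduct_sq_le u (x - u)
      rw [hu, one_mul] at hcs
      have h2 : -(1 / 32) ≤ u ⬝ᵥ (x - u) :=
        (abs_le.1 (abs_le_of_sq_le_sq (by linarith) (by norm_num))).1
      have h3 : x ⬝ᵥ x = u ⬝ᵥ u + 2 * (u ⬝ᵥ (x - u)) + d := by
        rw [hd]
        simp only [sub_dotProduct, dotProduct_sub, dotProduct_comm x u]
        ring
      linarith
    have hsum : ∑ i, (rowProj (coll i)ᵀ *ᵥ x) ⬝ᵥ (rowProj (coll i)ᵀ *ᵥ x) ≤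
        2 * ∑ i, (rowProj (coll i)ᵀ *ᵥ u) ⬝ᵥ (rowProj (coll i)ᵀ *ᵥ u) + N * (2 * d) := by
      calc _ ≤ ∑ i, (2 * ((rowProj (coll i)ᵀ *ᵥ u) ⬝ᵥ (rowProj (coll i)ᵀ *ᵥ u)) + 2 * d) :=
            Finset.sum_le_sum fun i _ => rowProj_mulVec_dotProduct_self_le_add _ _ _
        _ = _ := by simp [Finset.sum_add_distrib, Finset.mul_sum]
    have h4 : N * s / (16 * m) * (15 / 16 : ℝ) ≤ N * s / (16 * m) * (x ⬝ᵥ x) := by gcongr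
    have h5 : N * (2 * d) ≤ N * (2 * (s / (1024 * m))) := by
      gcongr
      exact hg.trans (by gcongr)
    have h6 : (N * s / (36 * m) : ℝ) = N * s / m * (1 / 36) := by ring
    have h7 : (N * s / (16 * m) * (15 / 16) : ℝ) = N * s / m * (15 / 256) := by ring
    have h8 : (N * (2 * (s / (1024 * m))) : ℝ) = N * s / m * (1 / 512) := by ring
    have h9 : 0 ≤ (N * s / m : ℝ) := by positivity
    have := h g
    linarith
  rcases (dotProduct_self_nonneg_real u).eq_or_lt with h0 | h0
  · rw [← h0, mul_zero]
    exact Finset.sum_nonneg fun i _ => dotProduct_self_nonneg_real _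
  · set r := √(u ⬝ᵥ u) with hr
    have hr2 : r * r = u ⬝ᵥ u := Real.mul_self_sqrt h0.le
    have hr0 : 0 < r := Real.sqrt_pos.2 h0
    have := key (r⁻¹ • u) (by
      rw [smul_dotProduct, dotProduct_smul, ← hr2, smul_eq_mul, smul_eq_mul]
      field_simp)
    simp only [mulVec_smul, smul_dotProduct, dotProduct_smul, smul_eq_mul, ← Finset.mul_sum] at this
    rw [← hr2]
    calc _ = (N * s / (36 * m)) * (r * r) := rfl
      _ ≤ (r⁻¹ * (r⁻¹ * _)) * (r * r) := by gcongr
      _ = _ := by field_simp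

theorem pow_mul_exp_neg_le_rpow {m N : ℕ} (hm : 2 ≤ m) {c : ℝ} (hc : 3 < c)
    (hN : 64 * c * (m : ℝ) ^ 2 * Real.log m ≤ N) :
    (64 * m + 1 : ℝ) ^ m * Real.exp (-(3 / 128 * N)) ≤ (m : ℝ) ^ (3 - c) := by
  have hm' : (2 : ℝ) ≤ m := by exact_mod_cast hm
  have hm0 : (0 : ℝ) < m := by linarith
  have hlog : 0 ≤ Real.log m := Real.log_nonneg (by linarith)
  have h1 : (64 * m + 1 : ℝ) ≤ (m : ℝ) ^ 8 := by
    have : (2 : ℝ) ^ 7 ≤ (m : ℝ) ^ 7 := by gcongr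
    nlinarith
  have h2 : (64 * m + 1 : ℝ) ^ m ≤ Real.exp (8 * m * Real.log m) := by
    calc (64 * m + 1 : ℝ) ^ m ≤ ((m : ℝ) ^ 8) ^ m := by gcongr
      _ = Real.exp (8 * m * Real.log m) := by
        rw [← pow_mul, ← Real.exp_log (pow_pos hm0 _), Real.log_pow]
        push_cast
        rfl
  rw [Real.rpow_def_of_pos hm0]
  refine (mul_le_mul_of_nonneg_right h2 (Real.exp_pos _).le).trans ?_
  rw [← Real.exp_add, Real.exp_le_exp]
  -- The right side is `(3/2) c m²`. At `c = 3` the claim is `8m ≤ (9/2) m²`, true for `m ≥ 2`;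
  -- beyond that the right side grows faster in `c`.
  have h3 : 8 * (m : ℝ) + (c - 3) ≤ 3 / 128 * (64 * c * (m : ℝ) ^ 2) := by
    nlinarith [mul_nonneg (sub_nonneg.2 hc.le) (by nlinarith : (0 : ℝ) ≤ 3 / 2 * (m : ℝ) ^ 2 - 1),
      mul_nonneg hm0.le (sub_nonneg.2 hm')]
  have h4 := mul_le_mul_of_nonneg_right h3 hlog
  nlinarith

/-! ### Union bound over the grid -/

section

variable {Ω : Type*} [MeasurableSpace Ω] {P : Measure Ω} {m s N : ℕ}
  {S : Fin N → Ω → Matrix (Fin m) (Fin s) ℝ}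

/-- `HasLaw` gives only a.e. measurability, while the independence arguments use measurable entries;
the modification changes events by null sets only. -/
theorem IsGaussianCollection.exists_measurable (hS : IsGaussianCollection P S) :
    ∃ S' : Fin N → Ω → Matrix (Fin m) (Fin s) ℝ, IsGaussianCollection P S' ∧
      (∀ k i j, Measurable fun ω => S' k ω i j) ∧ ∀ᵐ ω ∂P, ∀ k, S k ω = S' k ω := by
  have hae := fun k i j => (hS.hasLaw k i j).aemeasurable
  refine ⟨fun k ω => Matrix.of fun i j => (hae k i j).mk _ ω, ⟨fun k i j => ?_, ?_⟩,
    fun k i j => (hae k i j).measurable_mk, ?_⟩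
  · exact (hS.hasLaw k i j).congr (hae k i j).ae_eq_mk.symm
  · exact hS.indep.congr fun e => (hae e.1 e.2.1 e.2.2).ae_eq_mk
  · rw [ae_all_iff]
    intro k
    have : ∀ᵐ ω ∂P, ∀ i j, S k ω i j = (hae k i j).mk _ ω := by
      simp_rw [ae_all_iff]
      exact fun i j => (hae k i j).ae_eq_mk
    filter_upwards [this] with ω hω
    ext i j
    exact hω i j

theorem IsGaussianCollection.measureReal_exists_sum_rowProj_lt_le (hS : IsGaussianCollection P S)
    (hs : 0 < s) (hsm : s ≤ m) :
    P.real {ω | ∃ u : Fin m → ℝ, ∑ i, (rowProj (S i ω)ᵀ *ᵥ u) ⬝ᵥ (rowProj (S i ω)ᵀ *ᵥ u) <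
      N * s / (36 * m) * (u ⬝ᵥ u)} ≤ (64 * m + 1) ^ m * Real.exp (-(3 / 128 * N)) := by
  have hP : IsProbabilityMeasure P := hS.indep.isProbabilityMeasure
  have hm0 : 0 < m := hs.trans_le hsm
  obtain ⟨S', hS', hmeas, hae⟩ := hS.exists_measurable
  rw [measureReal_congr (t := {ω | ∃ u : Fin m → ℝ,
    ∑ i, (rowProj (S' i ω)ᵀ *ᵥ u) ⬝ᵥ (rowProj (S' i ω)ᵀ *ᵥ u) <
      N * s / (36 * m) * (u ⬝ᵥ u)})]
  swap
  · filter_upwards [hae] with ω hω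
    change (∃ u : Fin m → ℝ, _) = (∃ u : Fin m → ℝ, _)
    simp_rw [hω]
  set x := gridPoint m with hx
  set y : (Fin m → Fin (64 * m + 1)) → Fin m → ℝ := fun g => (√(x g ⬝ᵥ x g))⁻¹ • x g with hy
  -- The grid contains the origin, which cannot be normalised; requiring `y g ⬝ᵥ y g = 1` makes its
  -- event empty.
  set B : (Fin m → Fin (64 * m + 1)) → Set Ω := fun g =>
    {ω | y g ⬝ᵥ y g = 1 ∧ ∑ k, projLowerBound (y g) (S' k ω) ≤ N * s / (16 * m)} with hB
  have hsub : {ω | ∃ u : Fin m → ℝ,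
      ∑ i, (rowProj (S' i ω)ᵀ *ᵥ u) ⬝ᵥ (rowProj (S' i ω)ᵀ *ᵥ u) <
        N * s / (36 * m) * (u ⬝ᵥ u)} ⊆ ⋃ g, B g := by
    rintro ω ⟨u, hu⟩
    by_contra hω
    simp only [Set.mem_iUnion, not_exists] at hω
    refine absurd hu (not_lt.2 (le_sum_rowProj_of_gridPoint hm0 hs (fun i => S' i ω) ?_ u))
    intro g
    rcases (dotProduct_self_nonneg_real (x g)).eq_or_lt with h0 | h0
    · rw [← hx, ← h0, mul_zero]
      exact Finset.sum_nonneg fun i _ => dotProduct_self_nonneg_real _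
    · set r := √(x g ⬝ᵥ x g) with hr
      have hr2 : r * r = x g ⬝ᵥ x g := Real.mul_self_sqrt h0.le
      have hr0 : 0 < r := Real.sqrt_pos.2 h0
      have hyg : y g = r⁻¹ • x g := rfl
      have hy1 : y g ⬝ᵥ y g = 1 := by
        rw [hyg, smul_dotProduct, dotProduct_smul, ← hr2, smul_eq_mul, smul_eq_mul]
        field_simp
      have h1 : (N * s / (16 * m) : ℝ) < ∑ k, projLowerBound (y g) (S' k ω) := by
        by_contra hc
        exact hω g ⟨hy1, not_lt.1 hc⟩
      have h2 := h1.le.trans (Finset.sum_le_sum fun k _ => projLowerBound_le (y g) (S' k ω))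
      simp only [hyg, mulVec_smul, smul_dotProduct, dotProduct_smul, smul_eq_mul,
        ← Finset.mul_sum] at h2
      rw [← hx, ← hr2]
      calc _ = (N * s / (16 * m)) * (r * r) := rfl
        _ ≤ (r⁻¹ * (r⁻¹ * _)) * (r * r) := by gcongr
        _ = _ := by field_simp
  have hBg : ∀ g, P.real (B g) ≤ Real.exp (-(3 / 128 * N)) := by
    intro g
    by_cases h : y g ⬝ᵥ y g = 1
    · exact (measureReal_mono fun ω hω => hω.2).trans
        (measureReal_sum_projLowerBound_le hS' hmeas h hs hsm)
    · have : B g = ∅ := Set.eq_empty_of_forall_notMem fun ω hω => h hω.1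
      rw [this, measureReal_empty]
      exact (Real.exp_pos _).le
  calc _ ≤ P.real (⋃ g, B g) := measureReal_mono hsub
    _ ≤ ∑ g, P.real (B g) := measureReal_iUnion_fintype_le B
    _ ≤ ∑ _g : Fin m → Fin (64 * m + 1), Real.exp (-(3 / 128 * N)) :=
        Finset.sum_le_sum fun g _ => hBg g
    _ = _ := by simp

end

/-! ### Independent draws and the contraction in expectation -/

section sampling

variable {Ω : Type*} [MeasurableSpace Ω] {P : Measure Ω} {N : ℕ} {idx : ℕ → Ω → Fin N}

theorem IsUniformSampling.measureReal_preimage_singleton (h : IsUniformSampling P idx) (k : ℕ)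
    (i : Fin N) : P.real (idx k ⁻¹' {i}) = (N : ℝ)⁻¹ := by
  rw [← map_measureReal_apply_of_aemeasurable (h.hasLaw k).aemeasurable (measurableSet_singleton i),
    (h.hasLaw k).map_eq, measureReal_def, uniformOn_univ]
  simp

theorem finiteBGK_congr {m n s : ℕ} (A : Matrix (Fin m) (Fin n) ℝ) (b : Fin m → ℝ)
    (coll : Fin N → Matrix (Fin m) (Fin s) ℝ) (x₀ : Fin n → ℝ) {k : ℕ} {f g : ℕ → Fin N}
    (h : ∀ j < k, f j = g j) : finiteBGK A b coll f x₀ k = finiteBGK A b coll g x₀ k := by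
  induction k with
  | zero => rfl
  | succ k ih =>
    rw [finiteBGK, finiteBGK, h k (Nat.lt_succ_self k), ih fun j hj => h j (hj.trans k.lt_succ_self)]

/-- A function of the first `k` draws is integrable and independent of the draw number `k`. -/
theorem IsUniformSampling.integral_comp_succ [IsProbabilityMeasure P] (h : IsUniformSampling P idx)
    (k : ℕ) (F : Fin N → (ℕ → Fin N) → ℝ)
    (hF : ∀ i f g, (∀ j < k, f j = g j) → F i f = F i g) :
    (∀ i, Integrable (fun ω => F i fun j => idx j ω) P) ∧
      Integrable (fun ω => F (idx k ω) fun j => idx j ω) P ∧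
      ∫ ω, F (idx k ω) (fun j => idx j ω) ∂P =
        (N : ℝ)⁻¹ * ∑ i, ∫ ω, F i (fun j => idx j ω) ∂P := by
  classical
  obtain ⟨ω₀⟩ := nonempty_of_isProbabilityMeasure P
  have hae := fun j => (h.hasLaw j).aemeasurable
  -- `ext` extends the first `k` draws to a full sequence; the filler value is irrelevant because
  -- `F` reads only indices below `k`.
  let ext : (↥(Finset.range k) → Fin N) → ℕ → Fin N :=
    fun t j => if hj : j ∈ Finset.range k then t ⟨j, hj⟩ else idx 0 ω₀
  let T : Ω → (↥(Finset.range k) → Fin N) := fun ω j => idx j ω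
  have hT : AEMeasurable T P := aemeasurable_pi_lambda _ fun j => hae j
  have hFT : ∀ i ω, F i (fun j => idx j ω) = F i (ext (T ω)) := fun i ω => hF i _ _ fun j hj => by
    simp [ext, T, hj]
  have hmeas : ∀ i, Measurable fun t => F i (ext t) := fun i => measurable_of_finite _
  have hint : ∀ i, Integrable (fun ω => F i fun j => idx j ω) P := fun i => by
    simp_rw [hFT]
    obtain ⟨C, hC⟩ := (Set.finite_range fun t => ‖F i (ext t)‖).bddAbove
    exact Integrable.of_bound ((hmeas i).comp_aemeasurable hT).aestronglyMeasurable C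
      (ae_of_all _ fun ω => hC ⟨T ω, rfl⟩)
  have hind : IndepFun (idx k) T P := by
    have := h.indep.indepFun_finset₀ {k} (Finset.range k) (by simp) hae
    exact this.comp (φ := fun t => t ⟨k, Finset.mem_singleton_self k⟩) (ψ := id)
      (measurable_of_finite _) measurable_id
  let e : Fin N → Fin N → ℝ := fun i j => if j = i then 1 else 0
  have heint : ∀ i, Integrable (fun ω => e i (idx k ω)) P := fun i =>
    Integrable.of_bound ((measurable_of_finite (e i)).comp_aemeasurable
      (hae k)).aestronglyMeasurable 1 (ae_of_all _ fun ω => by simp only [e]; split_ifs <;> simp)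
  have he : ∀ i, ∫ ω, e i (idx k ω) ∂P = (N : ℝ)⁻¹ := fun i => by
    have he' : e i = Set.indicator {i} 1 := by
      ext j
      simp [e, Set.indicator_apply]
    rw [← h.measureReal_preimage_singleton k i,
      ← map_measureReal_apply_of_aemeasurable (hae k) (measurableSet_singleton i),
      ← integral_indicator_one (measurableSet_singleton i), ← he',
      integral_map (hae k) (measurable_of_finite (e i)).aestronglyMeasurable]
  have hindi : ∀ i, IndepFun (fun ω => e i (idx k ω)) (fun ω => F i fun j => idx j ω) P := by
    intro i
    simp_rw [hFT]
    exact hind.comp (measurable_of_finite (e i)) (hmeas i)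
  have hprod : ∀ i, Integrable (fun ω => e i (idx k ω) * F i fun j => idx j ω) P := fun i =>
    (hindi i).integrable_mul (heint i) (hint i)
  have hsum : ∀ ω, F (idx k ω) (fun j => idx j ω) =
      ∑ i, e i (idx k ω) * F i fun j => idx j ω := fun ω => by simp [e]
  refine ⟨hint, ?_, ?_⟩
  · simp_rw [hsum]
    exact integrable_finsetSum _ fun i _ => hprod i
  · simp_rw [hsum]
    rw [integral_finsetSum _ fun i _ => hprod i, Finset.mul_sum]
    refine Finset.sum_congr rfl fun i _ => ?_
    rw [(hindi i).integral_fun_mul_eq_mul_integral (heint i).aestronglyMeasurable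
      (hint i).aestronglyMeasurable, he]

theorem IsUniformSampling.integral_finiteBGK_le [IsProbabilityMeasure P]
    (h : IsUniformSampling P idx) {m n s : ℕ} (A : Matrix (Fin m) (Fin n) ℝ) (b : Fin m → ℝ)
    (xs : Fin n → ℝ) (hxs : A *ᵥ xs = b) (coll : Fin N → Matrix (Fin m) (Fin s) ℝ) {ρ : ℝ}
    (hρ : ∀ v : Fin n → ℝ, N * ρ * (v ⬝ᵥ v) ≤
      ∑ i, (rowProj ((coll i)ᵀ * A) *ᵥ v) ⬝ᵥ (rowProj ((coll i)ᵀ * A) *ᵥ v))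
    (x₀ : Fin n → ℝ) (k : ℕ) :
    Integrable (fun ω => euclNorm (finiteBGK A b coll (fun j => idx j ω) x₀ k - xs) ^ 2) P ∧
      ∫ ω, euclNorm (finiteBGK A b coll (fun j => idx j ω) x₀ k - xs) ^ 2 ∂P ≤
        (1 - ρ) ^ k * euclNorm (x₀ - xs) ^ 2 := by
  have hN : (0 : ℝ) < N := by
    obtain ⟨ω₀⟩ := nonempty_of_isProbabilityMeasure P
    exact_mod_cast (idx 0 ω₀).pos
  have hstep : ∀ v : Fin n → ℝ, (N : ℝ)⁻¹ * ∑ i, euclNorm ((1 - rowProj ((coll i)ᵀ * A)) *ᵥ v) ^ 2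
      ≤ (1 - ρ) * euclNorm v ^ 2 := by
    intro v
    simp_rw [euclNorm_sq, one_sub_rowProj_mulVec_dotProduct_self]
    rw [inv_mul_le_iff₀ hN, Finset.sum_sub_distrib]
    have := hρ v
    simp
    linarith
  induction k with
  | zero => simp [finiteBGK]
  | succ k ih =>
    obtain ⟨ihi, ih⟩ := ih
    let F : Fin N → (ℕ → Fin N) → ℝ := fun i f =>
      euclNorm ((1 - rowProj ((coll i)ᵀ * A)) *ᵥ (finiteBGK A b coll f x₀ k - xs)) ^ 2
    obtain ⟨h1, h2, h3⟩ := h.integral_comp_succ k F fun i f g hfg => by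
      simp only [F, finiteBGK_congr A b coll x₀ hfg]
    have hF : ∀ ω, euclNorm (finiteBGK A b coll (fun j => idx j ω) x₀ (k + 1) - xs) ^ 2 =
        F (idx k ω) (fun j => idx j ω) := fun ω => by
      simp only [F]
      rw [finiteBGK, sketchStep_sub A b xs hxs]
    simp_rw [hF]
    refine ⟨h2, ?_⟩
    rw [h3, ← integral_finsetSum _ fun i _ => h1 i, ← integral_const_mul]
    have hle : ∫ ω, (N : ℝ)⁻¹ * ∑ i, F i (fun j => idx j ω) ∂P ≤
        ∫ ω, (1 - ρ) * euclNorm (finiteBGK A b coll (fun j => idx j ω) x₀ k - xs) ^ 2 ∂P :=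
      integral_mono ((integrable_finsetSum _ fun i _ => h1 i).const_mul _) (ihi.const_mul _)
        fun ω => hstep _
    refine hle.trans ?_
    rw [integral_const_mul]
    rcases le_or_gt 0 (1 - ρ) with h0 | h0
    · calc _ ≤ (1 - ρ) * ((1 - ρ) ^ k * euclNorm (x₀ - xs) ^ 2) := by gcongr
        _ = _ := by ring
    -- A negative factor in `hstep`, whose left side is nonnegative, forces every vector to have
    -- norm zero.
    · have hz : ∀ v : Fin n → ℝ, euclNorm v ^ 2 = 0 := fun v => by
        have h5 : (0 : ℝ) ≤
            (N : ℝ)⁻¹ * ∑ i, euclNorm ((1 - rowProj ((coll i)ᵀ * A)) *ᵥ v) ^ 2 := by positivity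
        have h6 := hstep v
        have h7 : 0 ≤ euclNorm v ^ 2 := by positivity
        nlinarith
      simp [hz]

end sampling

/-! ### Assembly -/

theorem theorem3 {m n s N : ℕ} (hnm : n ≤ m) (hsm : s ≤ m)
    (A : Matrix (Fin m) (Fin n) ℝ) (hA : A.rank = n)
    (b : Fin m → ℝ) (xs : Fin n → ℝ) (hxs : A *ᵥ xs = b)
    (c : ℝ) (hc : 3 < c)
    (hN₁ : 64 * c * (m : ℝ) ^ 2 * Real.log m ≤ N) (hN₂ : (N : ℝ) ≤ Real.exp ((m : ℝ) / 3))
    {Ω : Type*} [MeasurableSpace Ω] (P : Measure Ω) [IsProbabilityMeasure P]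
    (S : Fin N → Ω → Matrix (Fin m) (Fin s) ℝ) (hS : IsGaussianCollection P S)
    {Ω' : Type*} [MeasurableSpace Ω'] (P' : Measure Ω') [IsProbabilityMeasure P']
    (idx : ℕ → Ω' → Fin N) (hidx : IsUniformSampling P' idx) :
    ∃ G : Set Ω, MeasurableSet G ∧
      1 - 1.1 * (m : ℝ) ^ (3 - c) ≤ P.real G ∧
      ∀ ω ∈ G, ∀ (x₀ : Fin n → ℝ) (k : ℕ),
        Integrable (fun ω' =>
          euclNorm (finiteBGK A b (fun i => S i ω) (fun j => idx j ω') x₀ k - xs) ^ 2) P' ∧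
        ∫ ω', euclNorm (finiteBGK A b (fun i => S i ω) (fun j => idx j ω') x₀ k - xs) ^ 2 ∂P' ≤
          (1 - (s : ℝ) / (36 * m * condNumber A ^ 2)) ^ k * euclNorm (x₀ - xs) ^ 2 := by
  have key : ∀ ω, (∀ u : Fin m → ℝ, N * s / (36 * m) * (u ⬝ᵥ u) ≤
      ∑ i, (rowProj (S i ω)ᵀ *ᵥ u) ⬝ᵥ (rowProj (S i ω)ᵀ *ᵥ u)) → ∀ (x₀ : Fin n → ℝ) (k : ℕ),
        Integrable (fun ω' =>
          euclNorm (finiteBGK A b (fun i => S i ω) (fun j => idx j ω') x₀ k - xs) ^ 2) P' ∧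
        ∫ ω', euclNorm (finiteBGK A b (fun i => S i ω) (fun j => idx j ω') x₀ k - xs) ^ 2 ∂P' ≤
          (1 - (s : ℝ) / (36 * m * condNumber A ^ 2)) ^ k * euclNorm (x₀ - xs) ^ 2 := by
    intro ω hω
    refine hidx.integral_finiteBGK_le A b xs hxs _ fun v => ?_
    refine le_trans (le_of_eq ?_) (le_sum_rowProj_mul A (fun i => S i ω) (by positivity) hω v)
    rw [mul_div_assoc, mul_div_assoc, div_div]
  have hm0 : 0 ≤ (m : ℝ) ^ (3 - c) := by positivity
  rcases Nat.eq_zero_or_pos s with rfl | hs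
  · refine ⟨Set.univ, .univ, by rw [probReal_univ]; linarith, fun ω _ => key ω fun u => ?_⟩
    rw [Nat.cast_zero, mul_zero, zero_div, zero_mul]
    exact Finset.sum_nonneg fun i _ => dotProduct_self_nonneg_real _
  rcases (hs.trans_le hsm).nat_succ_le.eq_or_lt with hm1 | hm1
  -- For `m = 1` the claimed probability is `1 - 1.1 < 0`.
  · refine ⟨∅, .empty, ?_, by simp⟩
    rw [← hm1]
    norm_num
  set B := {ω | ∃ u : Fin m → ℝ, ∑ i, (rowProj (S i ω)ᵀ *ᵥ u) ⬝ᵥ (rowProj (S i ω)ᵀ *ᵥ u) <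
    N * s / (36 * m) * (u ⬝ᵥ u)} with hB
  have hBm : P.real B ≤ (m : ℝ) ^ (3 - c) :=
    (hS.measureReal_exists_sum_rowProj_lt_le hs hsm).trans (pow_mul_exp_neg_le_rpow hm1 hc hN₁)
  -- Measurability of `B` is not established, so a measurable superset of the same measure is
  -- removed instead.
  refine ⟨(toMeasurable P B)ᶜ, (measurableSet_toMeasurable P B).compl, ?_, fun ω hω => key ω ?_⟩
  · rw [probReal_compl_eq_one_sub (measurableSet_toMeasurable P B), measureReal_def,
      measure_toMeasurable, ← measureReal_def]
    linarith
  · intro u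
    by_contra hu
    exact hω (subset_toMeasurable P B ⟨u, not_le.1 hu⟩)
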